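/- Let $r,s\ge 3$ and $\ell\ge 1$ be integers, and let $D=D_{r,s,\ell}$ be the dumbbell graph, obtained from two vertex-disjoint cycles $C_r$ and $C_s$ (of lengths $r$ and $s$) by choosing one vertex on each cycle and joining the two chosen vertices by a path of length $\ell$; thus $D$ has $r+s+\ell-1$ vertices. Let $\Phi=(D,\varphi)$ be a complex unit gain graph on $D$: $\varphi$ assigns to each oriented edge $(u,v)$ of $D$ a complex number of modulus $1$ such that $\varphi(u,v)=\varphi(v,u)^{-1}$. Let $A(\Phi)$ be the Hermitian matrix indexed by the vertices of $D$ with $A(\Phi)_{uv}=\varphi(u,v)$ if $u$ and $v$ are adjacent and $A(\Phi)_{uv}=0$ otherwise, and let $P_\Phi(x)=\det(xI-A(\Phi))$. The gain of a cycle is the product of the gains of its oriented edges when it is traversed once; its real part does not depend on the starting vertex or the direction. Let $a$ and $b$ be the real parts of the gains of $C_r$ and $C_s$, respectively. For a finite simple graph $G$ on $n$ vertices let $m_G(x)=\sum_{j=0}^{\lfloor n/2\rfloor}(-1)^j m(G,j)\,x^{n-2j}$ be its matching polynomial, where $m(G,j)$ is the number of sets of $j$ edges of $G$ no two of which share an endpoint.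 Let $D-C_r$ and $D-C_s$ be the graphs obtained from $D$ by deleting all vertices of $C_r$, respectively of $C_s$, and let $P_{\ell-1}$ be the path on $\ell-1$ vertices (the empty graph, with $m_{P_0}=1$, if $\ell=1$). Then $$P_\Phi(x)=m_{D}(x)-2a\,m_{D-C_r}(x)-2b\,m_{D-C_s}(x)+4ab\,m_{P_{\ell-1}}(x).$$ -/

import Mathlib

open Polynomial

/-- A complex unit gain graph with underlying simple graph `G`: every oriented edge (dart) carries
a complex number of modulus one, and reversing the edge inverts the gain. -/
structure UnitGainGraph {V : Type*} (G : SimpleGraph V) where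
  gain : G.Dart → Circle
  gain_symm : ∀ d : G.Dart, gain d.symm = (gain d)⁻¹

namespace UnitGainGraph

variable {V : Type*} {G : SimpleGraph V}

open Classical in
/-- The Hermitian adjacency matrix of a complex unit gain graph. -/
noncomputable def adjMatrix (Φ : UnitGainGraph G) : Matrix V V ℂ :=
  Matrix.of fun u v => if h : G.Adj u v then (Φ.gain ⟨(u, v), h⟩ : ℂ) else 0

/-- The characteristic polynomial `det (x I - A(Φ))` of a complex unit gain graph. -/
noncomputable def charPoly [Fintype V] [DecidableEq V] (Φ : UnitGainGraph G) : ℂ[X] :=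
  Φ.adjMatrix.charpoly

end UnitGainGraph

theorem cycleGraph_adj_finRotate {n : ℕ} (hn : 3 ≤ n) (i : Fin n) :
    (SimpleGraph.cycleGraph n).Adj i (finRotate n i) := by
  obtain ⟨m, rfl⟩ : ∃ m, n = m + 2 := ⟨n - 2, by omega⟩
  rw [SimpleGraph.cycleGraph_adj, finRotate_apply]
  right
  simp

/-- The gain of a cycle of length `n` in `G`, the cycle being given as an (injective) copy
`c 0, c 1, ..., c (n - 1)` of `C_n` in `G`: the product of the gains of the oriented edges met when
going once around it, `φ(c 0, c 1) φ(c 1, c 2) ⋯ φ(c (n - 1), c 0)`. -/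
noncomputable def UnitGainGraph.cycleGain {V : Type*} {G : SimpleGraph V} (Φ : UnitGainGraph G)
    {n : ℕ} (hn : 3 ≤ n) (c : SimpleGraph.Copy (SimpleGraph.cycleGraph n) G) : Circle :=
  ∏ i : Fin n,
    Φ.gain ⟨(c i, c (finRotate n i)), c.toHom.map_adj (cycleGraph_adj_finRotate hn i)⟩

/-- A set of edges of `G` no two of which share an endpoint. -/
def IsEdgeMatching {V : Type*} (G : SimpleGraph V) (M : Finset (Sym2 V)) : Prop :=
  (∀ e ∈ M, e ∈ G.edgeSet) ∧ ∀ e ∈ M, ∀ f ∈ M, e ≠ f → ∀ v, ¬ (v ∈ e ∧ v ∈ f)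

/-- The number `m(G, j)` of `j`-matchings of `G`. -/
noncomputable def numMatchings {V : Type*} [Finite V] (G : SimpleGraph V) (j : ℕ) : ℕ :=
  Nat.card {M : Finset (Sym2 V) // IsEdgeMatching G M ∧ M.card = j}

/-- The matching polynomial `∑_{j = 0}^{⌊n/2⌋} (-1)^j m(G, j) x^{n - 2j}`, where `n` is the order
of `G`, viewed with complex coefficients. -/
noncomputable def matchingPoly {V : Type*} [Finite V] (G : SimpleGraph V) : ℂ[X] :=
  ∑ j ∈ Finset.range (Nat.card V / 2 + 1),
    C ((-1 : ℂ) ^ j * (numMatchings G j : ℂ)) * X ^ (Nat.card V - 2 * j)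

/-- The vertices of the dumbbell graph: those of `C_r`, those of `C_s`, and the `ℓ - 1` interior
vertices of the connecting path. -/
abbrev DumbbellVertex (r s ℓ : ℕ) : Type := Fin r ⊕ Fin s ⊕ Fin (ℓ - 1)

/-- Adjacency in the dumbbell graph whose path of length `ℓ ≥ 1` joins the vertex `p` of `C_r` to
the vertex `q` of `C_s`. The interior path vertices are `0, ..., ℓ - 2`, listed from `p` to `q`;
for `ℓ = 1` the path is the single edge `p q`. -/
def dumbbellAdj {r s ℓ : ℕ} (p : Fin r) (q : Fin s) :
    DumbbellVertex r s ℓ → DumbbellVertex r s ℓ → Prop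
  | .inl i, .inl i' => (SimpleGraph.cycleGraph r).Adj i i'
  | .inl i, .inr (.inl j) => ℓ = 1 ∧ i = p ∧ j = q
  | .inl i, .inr (.inr k) => i = p ∧ (k : ℕ) = 0
  | .inr (.inl j), .inl i => ℓ = 1 ∧ i = p ∧ j = q
  | .inr (.inl j), .inr (.inl j') => (SimpleGraph.cycleGraph s).Adj j j'
  | .inr (.inl j), .inr (.inr k) => j = q ∧ (k : ℕ) + 2 = ℓ
  | .inr (.inr k), .inl i => i = p ∧ (k : ℕ) = 0
  | .inr (.inr k), .inr (.inl j) => j = q ∧ (k : ℕ) + 2 = ℓ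
  | .inr (.inr k), .inr (.inr k') => (SimpleGraph.pathGraph (ℓ - 1)).Adj k k'

/-- The dumbbell graph `D_{r,s,ℓ}`: the disjoint cycles `C_r` and `C_s`, with the chosen vertices
`p` of `C_r` and `q` of `C_s` joined by a path of length `ℓ`. -/
def dumbbell (r s ℓ : ℕ) (p : Fin r) (q : Fin s) : SimpleGraph (DumbbellVertex r s ℓ) where
  Adj := dumbbellAdj p q
  symm := ⟨by
    rintro (i | j | k) (i' | j' | k') h
    · exact SimpleGraph.Adj.symm h
    · exact h
    · exact h
    · exact h
    · exact SimpleGraph.Adj.symm h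
    · exact h
    · exact h
    · exact h
    · exact SimpleGraph.Adj.symm h⟩
  loopless := ⟨by
    rintro (i | j | k) h
    · exact (SimpleGraph.cycleGraph r).irrefl h
    · exact (SimpleGraph.cycleGraph s).irrefl h
    · exact (SimpleGraph.pathGraph (ℓ - 1)).irrefl h⟩

/-- The cycle `C_r` of the dumbbell graph. -/
def dumbbellCycleLeft (r s ℓ : ℕ) (p : Fin r) (q : Fin s) :
    SimpleGraph.Copy (SimpleGraph.cycleGraph r) (dumbbell r s ℓ p q) where
  toHom := { toFun := fun i => Sum.inl i, map_rel' := fun h => h }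
  injective' := fun _ _ h => Sum.inl_injective h

/-- The cycle `C_s` of the dumbbell graph. -/
def dumbbellCycleRight (r s ℓ : ℕ) (p : Fin r) (q : Fin s) :
    SimpleGraph.Copy (SimpleGraph.cycleGraph s) (dumbbell r s ℓ p q) where
  toHom := { toFun := fun j => Sum.inr (Sum.inl j), map_rel' := fun h => h }
  injective' := fun _ _ h => Sum.inl_injective (Sum.inr_injective h)

/-- The graph `G - H` obtained by deleting from `G` the vertices of a copy of `H` in `G`. -/
abbrev deleteCopy {V W : Type*} (G : SimpleGraph V) {H : SimpleGraph W}
    (c : SimpleGraph.Copy H G) : SimpleGraph ↥((Set.range c)ᶜ : Set V) :=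
  G.induce (Set.range c)ᶜ

/-! Expand `det (xI - A)` by Leibniz. A permutation contributes only if it sends every vertex it
moves to a neighbour. A fixed point then contributes `x`, and a two-element orbit `{u, v}`
contributes `-A u v * A v u = -1`, whatever the gain. So the involutions correspond to matchings and
sum to the matching polynomial (`involutionSum_charmatrix`).

The edges of the connecting path are bridges, and a permutation that crosses a bridge must swap its
ends (`apply_eq_of_bridge`, `dumbbell_bridge_unique`). Hence a contributing permutation is an
involution on the interior of the path, and on each of `C_r`, `C_s` it is an involution or one of
the two rotations (`involution_or_rotation`). The two rotations of a cycle contribute minus its gain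
and minus the conjugate, together `-2a` or `-2b` (`permTerm_rotation_add`); the involutions on the
remaining vertices give the matching polynomial of what is left. The 3 × 3 patterns on the two
cycles add up to the formula (`sum_eq_sum_patterns`). -/

/-- The term of the permutation `σ` in the Leibniz expansion of `det M`. -/
def permTerm {V R : Type*} [Fintype V] [DecidableEq V] [CommRing R] (M : Matrix V V R)
    (σ : Equiv.Perm V) : R :=
  ((Equiv.Perm.sign σ : ℤ) : R) * ∏ i, M (σ i) i

/-- The part of the Leibniz expansion of `det M` given by the involutions. -/
def involutionSum {V R : Type*} [Fintype V] [DecidableEq V] [CommRing R] (M : Matrix V V R) : R :=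
  ∑ σ : Equiv.Perm V with ∀ v, σ (σ v) = v, permTerm M σ

/-! ### Involutions and matchings. -/

theorem even_card_support_of_involution {V : Type*} [Fintype V] [DecidableEq V]
    {σ : Equiv.Perm V} (hσ : ∀ v, σ (σ v) = v) :
    ∃ m, σ.support.card = 2 * m ∧ (Equiv.Perm.sign σ : ℤ) = (-1) ^ m := by
  have h2 : σ.cycleType = Multiset.replicate σ.cycleType.card 2 := by
    refine Multiset.eq_replicate.2 ⟨rfl, fun b hb => ?_⟩
    have h1 := Equiv.Perm.two_le_of_mem_cycleType hb
    have h3 : orderOf σ ∣ 2 := orderOf_dvd_of_pow_eq_one (by ext v; simp [pow_two, hσ])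
    exact le_antisymm (Nat.le_of_dvd two_pos
      ((Equiv.Perm.dvd_of_mem_cycleType hb).trans h3)) h1
  have hsum : σ.cycleType.sum = 2 * σ.cycleType.card := by
    conv_lhs => rw [h2]
    simp [mul_comm]
  refine ⟨σ.cycleType.card, by rw [← Equiv.Perm.sum_cycleType, hsum], ?_⟩
  rw [Equiv.Perm.sign_of_cycleType, hsum, pow_add, pow_mul]
  simp

/-- Pairing `v` with `σ v` cancels the gains, fixed points give `X` because there are no loops, and
only the sign of the `m` transpositions is left. -/
theorem permTerm_charmatrix_of_involution {V : Type*} [Fintype V] [DecidableEq V]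
    {G : SimpleGraph V} {A : Matrix V V ℂ} (hA : ∀ u v, G.Adj u v → A u v * A v u = 1)
    (hA₀ : ∀ u v, ¬ G.Adj u v → A u v = 0) {σ : Equiv.Perm V} (hσ : ∀ v, σ (σ v) = v)
    (hG : ∀ v, σ v ≠ v → G.Adj v (σ v)) {m : ℕ} (hm : σ.support.card = 2 * m) :
    permTerm A.charmatrix σ = C ((-1 : ℂ) ^ m) * X ^ (Fintype.card V - 2 * m) := by
  obtain ⟨m', hm', hs⟩ := even_card_support_of_involution hσ
  obtain rfl : m' = m := by omega
  have h1 : ∏ i ∈ σ.support, A.charmatrix (σ i) i = 1 := by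
    refine Finset.prod_involution (fun i _ => σ i) (fun i hi => ?_) (fun i hi _ => ?_)
      (fun i hi => ?_) (fun i _ => hσ i)
    · have hi' := Equiv.Perm.mem_support.1 hi
      rw [hσ, Matrix.charmatrix_apply_ne _ _ _ hi', Matrix.charmatrix_apply_ne _ _ _ hi'.symm,
        neg_mul_neg, ← C_mul, hA _ _ (hG i hi').symm, C_1]
    · exact Equiv.Perm.mem_support.1 hi
    · exact Equiv.Perm.apply_mem_support.2 hi
  have h2 : ∏ i ∈ σ.supportᶜ, A.charmatrix (σ i) i = X ^ (Fintype.card V - 2 * m') := by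
    rw [Finset.prod_congr rfl (g := fun _ => X), Finset.prod_const, Finset.card_compl, hm]
    intro i hi
    have hi' : σ i = i := by simpa using hi
    rw [hi', Matrix.charmatrix_apply_eq, hA₀ i i (G.irrefl), C_0, sub_zero]
  rw [permTerm, ← Finset.prod_mul_prod_compl σ.support, h1, h2, hs]
  simp

theorem permTerm_charmatrix_eq_zero {V : Type*} [Fintype V] [DecidableEq V]
    {G : SimpleGraph V} {A : Matrix V V ℂ}
    (hA₀ : ∀ u v, ¬ G.Adj u v → A u v = 0) {σ : Equiv.Perm V} {v : V} (hv : σ v ≠ v)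
    (hG : ¬ G.Adj v (σ v)) : permTerm A.charmatrix σ = 0 := by
  rw [permTerm, Finset.prod_eq_zero (Finset.mem_univ v), mul_zero]
  rw [Matrix.charmatrix_apply_ne _ _ _ hv, hA₀ _ _ (fun h => hG h.symm), C_0, neg_zero]

/-- The set of two-element orbits of a permutation. -/
def involutionEdges {V : Type*} [Fintype V] [DecidableEq V] (σ : Equiv.Perm V) :
    Finset (Sym2 V) :=
  σ.support.image fun v => s(v, σ v)

theorem mk_mem_involutionEdges {V : Type*} [Fintype V] [DecidableEq V] {σ : Equiv.Perm V}
    (hσ : ∀ v, σ (σ v) = v) {u v : V} : s(u, v) ∈ involutionEdges σ ↔ u ≠ v ∧ σ u = v := by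
  simp only [involutionEdges, Finset.mem_image, Equiv.Perm.mem_support, Sym2.eq_iff]
  constructor
  · rintro ⟨w, hw, ⟨rfl, rfl⟩ | ⟨rfl, rfl⟩⟩
    · exact ⟨hw.symm, rfl⟩
    · exact ⟨hw, hσ _⟩
  · rintro ⟨h, rfl⟩
    exact ⟨u, h.symm, Or.inl ⟨rfl, rfl⟩⟩

theorem IsEdgeMatching.eq_of_mem {V : Type*} {G : SimpleGraph V} {M : Finset (Sym2 V)}
    (hM : IsEdgeMatching G M) {u v w : V} (hv : s(u, v) ∈ M) (hw : s(u, w) ∈ M) : v = w := by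
  by_contra hne
  refine hM.2 _ hv _ hw (fun h => hne ?_) u ⟨Sym2.mem_mk_left _ _, Sym2.mem_mk_left _ _⟩
  exact Sym2.congr_right.1 h

theorem isEdgeMatching_involutionEdges {V : Type*} [Fintype V] [DecidableEq V]
    {G : SimpleGraph V} {σ : Equiv.Perm V} (hσ : ∀ v, σ (σ v) = v)
    (hG : ∀ v, σ v ≠ v → G.Adj v (σ v)) : IsEdgeMatching G (involutionEdges σ) := by
  constructor
  · rintro ⟨u, v⟩ h
    obtain ⟨h, rfl⟩ := (mk_mem_involutionEdges hσ).1 h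
    exact hG u h.symm
  · intro e he f hf hne v ⟨hve, hvf⟩
    obtain ⟨u, rfl⟩ := Sym2.mem_iff_exists.1 hve
    obtain ⟨w, rfl⟩ := Sym2.mem_iff_exists.1 hvf
    exact hne (by rw [← ((mk_mem_involutionEdges hσ).1 he).2, ← ((mk_mem_involutionEdges hσ).1 hf).2])

theorem IsEdgeMatching.card_biUnion {V : Type*} [DecidableEq V] {G : SimpleGraph V}
    {M : Finset (Sym2 V)} (hM : IsEdgeMatching G M) :
    (M.biUnion Sym2.toFinset).card = 2 * M.card := by
  rw [Finset.card_biUnion, Finset.sum_congr rfl (g := fun _ => 2)]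
  · simp [mul_comm]
  · intro e he
    exact Sym2.card_toFinset_of_not_isDiag _ (G.not_isDiag_of_mem_edgeSet (hM.1 e he))
  · intro e he f hf hne
    refine Finset.disjoint_left.2 fun v hve hvf => ?_
    exact hM.2 e he f hf hne v ⟨Sym2.mem_toFinset.1 hve, Sym2.mem_toFinset.1 hvf⟩

theorem support_eq_biUnion_involutionEdges {V : Type*} [Fintype V] [DecidableEq V]
    {σ : Equiv.Perm V} (hσ : ∀ v, σ (σ v) = v) :
    σ.support = (involutionEdges σ).biUnion Sym2.toFinset := by
  ext v
  simp only [Finset.mem_biUnion, Sym2.mem_toFinset, Equiv.Perm.mem_support]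
  constructor
  · intro h
    exact ⟨s(v, σ v), (mk_mem_involutionEdges hσ).2 ⟨h.symm, rfl⟩, Sym2.mem_mk_left _ _⟩
  · rintro ⟨e, he, hv⟩
    obtain ⟨u, rfl⟩ := Sym2.mem_iff_exists.1 hv
    obtain ⟨h, rfl⟩ := (mk_mem_involutionEdges hσ).1 he
    exact h.symm

theorem exists_involution_of_isEdgeMatching {V : Type*} [Fintype V] [DecidableEq V]
    {G : SimpleGraph V} {M : Finset (Sym2 V)} (hM : IsEdgeMatching G M) :
    ∃ σ : Equiv.Perm V, (∀ v, σ (σ v) = v) ∧ (∀ v, σ v ≠ v → G.Adj v (σ v)) ∧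
      involutionEdges σ = M := by
  classical
  -- `f` swaps the ends of each edge of `M` and fixes the vertices that `M` leaves uncovered.
  let f : V → V := fun v => if h : ∃ u, s(v, u) ∈ M then h.choose else v
  have hf : ∀ {u v}, s(u, v) ∈ M → f u = v := fun {u v} h => by
    have h' : ∃ v, s(u, v) ∈ M := ⟨v, h⟩
    simp only [f, dif_pos h']
    exact hM.eq_of_mem h'.choose_spec h
  have hf' : ∀ {v}, f v ≠ v → s(v, f v) ∈ M := fun {v} h => by
    by_cases h' : ∃ u, s(v, u) ∈ M
    · obtain ⟨u, hu⟩ := h'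
      rwa [hf hu]
    · exact absurd (dif_neg h') h
  have hinv : Function.Involutive f := fun v => by
    by_cases h : f v = v
    · rw [h, h]
    · exact hf (Sym2.eq_swap ▸ hf' h)
  refine ⟨hinv.toPerm f, hinv, fun v hv => hM.1 _ (hf' hv), ?_⟩
  ext e
  induction e with | _ u v
  rw [mk_mem_involutionEdges (σ := hinv.toPerm f) hinv]
  constructor
  · rintro ⟨h, rfl⟩
    exact hf' h.symm
  · intro h
    exact ⟨G.ne_of_adj (hM.1 _ h), hf h⟩

-- Grouping matchings by size loses nothing: a matching covers `2 * M.card` distinct vertices, so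
-- its size lies in the range of `j`.
open Classical in
theorem matchingPoly_eq_sum_isEdgeMatching {V : Type*} [Fintype V] (G : SimpleGraph V) :
    matchingPoly G = ∑ M : Finset (Sym2 V) with IsEdgeMatching G M,
      C ((-1 : ℂ) ^ M.card) * X ^ (Fintype.card V - 2 * M.card) := by
  rw [matchingPoly, ← Finset.sum_fiberwise_of_maps_to
    (t := Finset.range (Nat.card V / 2 + 1)) (g := Finset.card)]
  · refine Finset.sum_congr rfl fun j _ => ?_
    rw [Finset.sum_congr rfl (g := fun _ => C ((-1 : ℂ) ^ j) * X ^ (Nat.card V - 2 * j))]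
    · rw [Finset.sum_const, numMatchings, Nat.card_eq_fintype_card, Fintype.card_subtype,
        Finset.filter_filter, nsmul_eq_mul, C_mul]
      simp only [map_natCast]
      ring
    · intro M hM
      rw [(Finset.mem_filter.1 hM).2, Nat.card_eq_fintype_card]
  · intro M hM
    have h1 := (Finset.mem_filter.1 hM).2.card_biUnion
    have h2 := Finset.card_le_univ (M.biUnion Sym2.toFinset)
    rw [Finset.mem_range, Nat.card_eq_fintype_card]
    omega

/-- Taking two-element orbits is a bijection from the involutions that move vertices along edges to
the matchings; all other involutions have zero term. -/
theorem involutionSum_charmatrix {V : Type*} [Fintype V] [DecidableEq V]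
    {G : SimpleGraph V} {A : Matrix V V ℂ} (hA : ∀ u v, G.Adj u v → A u v * A v u = 1)
    (hA₀ : ∀ u v, ¬ G.Adj u v → A u v = 0) :
    involutionSum A.charmatrix = matchingPoly G := by
  classical
  rw [matchingPoly_eq_sum_isEdgeMatching, involutionSum,
    ← Finset.sum_filter_of_ne (p := fun σ => ∀ v, σ v ≠ v → G.Adj v (σ v))]
  · rw [Finset.filter_filter]
    refine Finset.sum_bij (fun σ _ => involutionEdges σ) ?_ ?_ ?_ ?_
    · intro σ h
      obtain ⟨hσ, hG⟩ := (Finset.mem_filter.1 h).2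
      exact Finset.mem_filter.2 ⟨Finset.mem_univ _, isEdgeMatching_involutionEdges hσ hG⟩
    · intro σ h τ h' heq
      obtain ⟨hσ, -⟩ := (Finset.mem_filter.1 h).2
      obtain ⟨hτ, -⟩ := (Finset.mem_filter.1 h').2
      ext v
      have key : ∀ u, (v ≠ u ∧ σ v = u) ↔ (v ≠ u ∧ τ v = u) := fun u => by
        rw [← mk_mem_involutionEdges hσ, ← mk_mem_involutionEdges hτ, heq]
      by_cases hv : σ v = v
      · by_contra hne
        rw [hv] at hne
        exact hne (((key (τ v)).2 ⟨hne, rfl⟩).2 ▸ hv).symm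
      · exact ((key (σ v)).1 ⟨Ne.symm hv, rfl⟩).2.symm
    · intro M hM
      obtain ⟨σ, hσ, hG, rfl⟩ := exists_involution_of_isEdgeMatching (Finset.mem_filter.1 hM).2
      exact ⟨σ, Finset.mem_filter.2 ⟨Finset.mem_univ _, hσ, hG⟩, rfl⟩
    · intro σ h
      obtain ⟨hσ, hG⟩ := (Finset.mem_filter.1 h).2
      refine permTerm_charmatrix_of_involution hA hA₀ hσ hG ?_
      rw [support_eq_biUnion_involutionEdges hσ,
        (isEdgeMatching_involutionEdges hσ hG).card_biUnion]
  · intro σ _ hne v hv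
    by_contra hG
    exact hne (permTerm_charmatrix_eq_zero hA₀ hv hG)

/-! ### Factoring terms along a partition of the vertices. -/

theorem permTerm_permCongr {U V R : Type*} [Fintype U] [DecidableEq U] [Fintype V] [DecidableEq V]
    [CommRing R] (M : Matrix V V R) (e : U ≃ V) (σ : Equiv.Perm U) :
    permTerm M (e.permCongr σ) = permTerm (M.submatrix e e) σ := by
  rw [permTerm, permTerm, Equiv.Perm.sign_permCongr, ← Equiv.prod_comp e]
  simp

theorem permTerm_sumCongr {W U R : Type*} [Fintype U] [DecidableEq U] [Fintype W] [DecidableEq W]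
    [CommRing R] (M : Matrix (W ⊕ U) (W ⊕ U) R) (ρ : Equiv.Perm W) (τ : Equiv.Perm U) :
    permTerm M (ρ.sumCongr τ) =
      permTerm (M.submatrix Sum.inl Sum.inl) ρ * permTerm (M.submatrix Sum.inr Sum.inr) τ := by
  simp only [permTerm, Equiv.Perm.sign_sumCongr, Fintype.prod_sum_type]
  simp
  ring

theorem exists_sumCongr_of_apply_inl {W U : Type*} [Finite W] [Finite U]
    {σ : Equiv.Perm (W ⊕ U)} {ρ : Equiv.Perm W} (h : ∀ i, σ (.inl i) = .inl (ρ i)) :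
    ∃ τ : Equiv.Perm U, ρ.sumCongr τ = σ := by
  obtain ⟨⟨ρ', τ⟩, rfl⟩ := Equiv.Perm.mem_sumCongrHom_range_of_perm_mapsTo_inl (σ := σ) (by
    rintro _ ⟨i, rfl⟩
    exact ⟨ρ i, (h i).symm⟩)
  refine ⟨τ, ?_⟩
  obtain rfl : ρ' = ρ := by
    ext i
    exact Sum.inl_injective (h i)
  rfl

/-- The terms of the permutations that act on a set of vertices as a given permutation and on its
complement as an involution. -/
theorem sum_permTerm_of_apply_eq {W U V R : Type*} [Fintype W] [DecidableEq W] [Fintype U]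
    [DecidableEq U] [Fintype V] [DecidableEq V] [CommRing R] (M : Matrix V V R) (e : W ⊕ U ≃ V)
    (ρ : Equiv.Perm W) (P : Equiv.Perm V → Prop) [DecidablePred P]
    (hP : ∀ σ, P σ ↔ (∀ i, σ (e (.inl i)) = e (.inl (ρ i))) ∧
      ∀ j, σ (σ (e (.inr j))) = e (.inr j)) :
    ∑ σ with P σ, permTerm M σ =
      permTerm (M.submatrix (e ∘ Sum.inl) (e ∘ Sum.inl)) ρ *
        involutionSum (M.submatrix (e ∘ Sum.inr) (e ∘ Sum.inr)) := by
  rw [involutionSum, Finset.mul_sum]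
  symm
  refine Finset.sum_bij (fun τ _ => e.permCongr (ρ.sumCongr τ)) ?_ ?_ ?_ ?_
  · intro τ h
    have hτ := (Finset.mem_filter.1 h).2
    simp [hP, hτ]
  · intro τ _ τ' _ h
    ext j
    simpa using DFunLike.congr_fun (e.permCongr.injective h) (.inr j)
  · intro σ h
    obtain ⟨h1, h2⟩ := (hP σ).1 (Finset.mem_filter.1 h).2
    obtain ⟨τ, hτ⟩ := exists_sumCongr_of_apply_inl (σ := e.symm.permCongr σ) (ρ := ρ)
      (fun i => by simp [h1])
    obtain rfl : e.permCongr (ρ.sumCongr τ) = σ := by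
      rw [hτ]; ext; simp
    exact ⟨τ, Finset.mem_filter.2 ⟨Finset.mem_univ _, fun j => by simpa using h2 j⟩, rfl⟩
  · intro τ _
    rw [permTerm_permCongr, permTerm_sumCongr]
    rfl

/-! ### Permutations at a bridge and on a cycle. -/

/-- The only way back into `S` is from `v` to `u`. If `σ` does not use it, `σ` maps the complement
of `S` into itself, and by finiteness so does its inverse; but the inverse takes `v` to `u`. -/
theorem apply_eq_of_bridge {V : Type*} [Finite V] {G : SimpleGraph V} {σ : Equiv.Perm V}
    (hσ : ∀ v, σ v ≠ v → G.Adj v (σ v)) {S : Set V} {u v : V} (hv : v ∉ S)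
    (hS : ∀ a ∈ S, ∀ b ∉ S, G.Adj a b → a = u ∧ b = v) (hu : u ∈ S) (h : σ u = v) : σ v = u := by
  by_contra hne
  have hmaps : Set.MapsTo σ Sᶜ Sᶜ := fun b hb hbS => by
    have hb' : σ b ≠ b := fun h => hb (h ▸ hbS)
    obtain ⟨h1, rfl⟩ := hS _ hbS b hb (hσ b hb').symm
    exact hne h1
  exact Equiv.Perm.perm_symm_mapsTo_of_mapsTo σ hmaps hv (by
    rwa [← h, Equiv.symm_apply_apply])

/-- The direction propagates: after a step from `c j` to `c (ρ j)`, turning back would create a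
two-element orbit, so the next step goes forward as well. -/
theorem apply_eq_of_rotation {V W : Type*} [Finite W] {σ : Equiv.Perm V} {c : W → V}
    {ρ : Equiv.Perm W} (hρ : ∀ i j, ρ.SameCycle i j)
    (hσ : ∀ i, σ (σ (c i)) ≠ c i → σ (c i) = c (ρ i) ∨ σ (c i) = c (ρ.symm i))
    {i₀ : W} (h : σ (c i₀) = c (ρ i₀)) (h' : σ (σ (c i₀)) ≠ c i₀) (i : W) :
    σ (c i) = c (ρ i) := by
  obtain ⟨n, -, rfl⟩ := (hρ i₀ i).exists_pow_eq'
  suffices H : σ (c ((ρ ^ n) i₀)) = c (ρ ((ρ ^ n) i₀)) ∧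
      σ (σ (c ((ρ ^ n) i₀))) ≠ c ((ρ ^ n) i₀) from H.1
  induction n with
  | zero => exact ⟨h, h'⟩
  | succ n ih =>
    rw [pow_succ', Equiv.Perm.mul_apply]
    generalize (ρ ^ n) i₀ = j at ih
    obtain ⟨h1, h2⟩ := ih
    rw [h1] at h2
    have hinv : σ (σ (c (ρ j))) ≠ c (ρ j) := fun H => by
      rw [← h1] at H
      exact h2 (h1 ▸ σ.injective H)
    refine ⟨(hσ (ρ j) hinv).resolve_right fun H => h2 ?_, hinv⟩
    rwa [Equiv.symm_apply_apply] at H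

/-- A permutation moving the vertices of a cycle along its edges, except for those that lie on
two-element orbits, is an involution on the cycle or rotates it. -/
theorem involution_or_rotation {V W : Type*} [Finite W] {σ : Equiv.Perm V} {c : W → V}
    {ρ : Equiv.Perm W} (hρ : ∀ i j, ρ.SameCycle i j)
    (hσ : ∀ i, σ (σ (c i)) ≠ c i → σ (c i) = c (ρ i) ∨ σ (c i) = c (ρ.symm i)) :
    (∀ i, σ (σ (c i)) = c i) ∨ (∀ i, σ (c i) = c (ρ i)) ∨ ∀ i, σ (c i) = c (ρ.symm i) := by
  by_cases h : ∀ i, σ (σ (c i)) = c i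
  · exact Or.inl h
  · push Not at h
    obtain ⟨i₀, h⟩ := h
    refine Or.inr ((hσ i₀ h).imp (fun h1 => apply_eq_of_rotation hρ hσ h1 h) fun h1 => ?_)
    exact apply_eq_of_rotation (ρ := ρ.symm) (fun i j => Equiv.Perm.sameCycle_inv.2 (hρ i j))
      (fun i hi => (hσ i hi).symm) h1 h

/-- The three cases exclude each other because `ρ` has no two-element orbit or fixed point; this is
where cycle length at least 3 enters. -/
theorem sum_indicator_involution_rotation {V W R : Type*} [Nonempty W] [CommRing R]
    {σ : Equiv.Perm V} {c : W → V} (hc : Function.Injective c) {ρ : Equiv.Perm W}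
    [Decidable (∀ i, σ (σ (c i)) = c i)] [Decidable (∀ i, σ (c i) = c (ρ i))]
    [Decidable (∀ i, σ (c i) = c (ρ.symm i))] (hρ : ∀ i, ρ (ρ i) ≠ i)
    (hσ : (∀ i, σ (σ (c i)) = c i) ∨ (∀ i, σ (c i) = c (ρ i)) ∨ ∀ i, σ (c i) = c (ρ.symm i)) :
    (if ∀ i, σ (σ (c i)) = c i then 1 else 0) + (if ∀ i, σ (c i) = c (ρ i) then 1 else 0) +
      (if ∀ i, σ (c i) = c (ρ.symm i) then 1 else 0) = (1 : R) := by
  obtain ⟨i⟩ := ‹Nonempty W›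
  have h12 : (∀ i, σ (σ (c i)) = c i) → ¬ ∀ i, σ (c i) = c (ρ i) := fun h h' =>
    hρ i (hc (by rw [← h', ← h', h]))
  have h13 : (∀ i, σ (σ (c i)) = c i) → ¬ ∀ i, σ (c i) = c (ρ.symm i) := fun h h' =>
    hρ i (by
      have := hc ((h i).symm.trans (by rw [h', h']))
      rw [this]; simpa using this)
  have h23 : (∀ i, σ (c i) = c (ρ i)) → ¬ ∀ i, σ (c i) = c (ρ.symm i) := fun h h' =>
    hρ i ((Equiv.eq_symm_apply ρ).1 (hc ((h i).symm.trans (h' i))))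
  by_cases h1 : ∀ i, σ (σ (c i)) = c i
  · rw [if_pos h1, if_neg (h12 h1), if_neg (h13 h1)]; simp
  · by_cases h2 : ∀ i, σ (c i) = c (ρ i)
    · rw [if_neg h1, if_pos h2, if_neg (h23 h2)]; simp
    · have h3 := (hσ.resolve_left h1).resolve_left h2
      rw [if_neg h1, if_neg h2, if_pos h3]; simp

/-! ### Rotations of a cycle and their terms. -/

theorem finRotate_sameCycle {n : ℕ} (hn : 3 ≤ n) (i j : Fin n) : (finRotate n).SameCycle i j := by
  obtain ⟨m, rfl⟩ : ∃ m, n = m + 2 := ⟨n - 2, by omega⟩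
  have h : ∀ i, finRotate (m + 2) i ≠ i := fun i => by
    rw [← Equiv.Perm.mem_support, support_finRotate]
    exact Finset.mem_univ i
  exact isCycle_finRotate.sameCycle (h i) (h j)

theorem finRotate_finRotate_ne {n : ℕ} (hn : 3 ≤ n) (i : Fin n) :
    finRotate n (finRotate n i) ≠ i := by
  obtain ⟨m, rfl⟩ : ∃ m, n = m + 3 := ⟨n - 3, by omega⟩
  simp only [finRotate_apply, add_assoc, ne_eq, add_eq_left]
  simp [Fin.ext_iff, Fin.val_add, Nat.mod_eq_of_lt (show 2 < m + 3 by omega)]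

theorem cycleGraph_adj_iff_finRotate {n : ℕ} (hn : 3 ≤ n) {i j : Fin n}
    (h : (SimpleGraph.cycleGraph n).Adj i j) : j = finRotate n i ∨ j = (finRotate n).symm i := by
  obtain ⟨m, rfl⟩ : ∃ m, n = m + 2 := ⟨n - 2, by omega⟩
  rw [SimpleGraph.cycleGraph_adj] at h
  rw [Equiv.eq_symm_apply, finRotate_apply, finRotate_apply]
  rcases h with h | h
  · right; rw [← h]; abel
  · left; rw [← h]; abel

theorem charmatrix_submatrix {U V R : Type*} [Fintype U] [DecidableEq U] [Fintype V]
    [DecidableEq V] [CommRing R] (A : Matrix V V R) {f : U → V} (hf : Function.Injective f) :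
    A.charmatrix.submatrix f f = (A.submatrix f f).charmatrix := by
  ext1 i j
  simp [Matrix.charmatrix_apply, Matrix.diagonal_apply, hf.eq_iff]

/-- An `n`-cycle has sign `(-1)^(n-1)` and the `n` off-diagonal entries `-A` give `(-1)^n`, so the
total sign is always `-1`. -/
theorem permTerm_charmatrix_rotation {V : Type*} [Fintype V] [DecidableEq V] (A : Matrix V V ℂ)
    {n : ℕ} (hn : 3 ≤ n) {c : Fin n → V} (hc : Function.Injective c) :
    permTerm (A.charmatrix.submatrix c c) (finRotate n) =
      -C (∏ i, A (c (finRotate n i)) (c i)) := by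
  have h : ∀ i, A.charmatrix.submatrix c c (finRotate n i) i = -C (A (c (finRotate n i)) (c i)) :=
    fun i => by
      rw [Matrix.submatrix_apply, Matrix.charmatrix_apply_ne]
      intro h
      have h := hc h
      exact finRotate_finRotate_ne hn i (by rw [h, h])
  obtain ⟨m, rfl⟩ : ∃ m, n = m + 1 := ⟨n - 1, by omega⟩
  rw [permTerm, sign_finRotate, Finset.prod_congr rfl fun i _ => h i, Finset.prod_neg, map_prod]
  have h2 : ((-1 : ℂ[X]) ^ m) * (-1) ^ m = 1 := by rw [← mul_pow]; simp
  simp only [Finset.card_univ, Fintype.card_fin, add_tsub_cancel_right, pow_succ]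
  push_cast
  linear_combination (-(∏ i, C (A (c (finRotate (m + 1) i)) (c i)))) * h2

theorem permTerm_symm {V R : Type*} [Fintype V] [DecidableEq V] [CommRing R] (M : Matrix V V R)
    (σ : Equiv.Perm V) : permTerm M σ.symm = permTerm M.transpose σ := by
  rw [permTerm, permTerm, Equiv.Perm.sign_symm, ← Equiv.prod_comp σ]
  simp

theorem permTerm_charmatrix_rotation_symm {V : Type*} [Fintype V] [DecidableEq V]
    (A : Matrix V V ℂ) {n : ℕ} (hn : 3 ≤ n) {c : Fin n → V} (hc : Function.Injective c) :
    permTerm (A.charmatrix.submatrix c c) (finRotate n).symm =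
      -C (∏ i, A (c i) (c (finRotate n i))) := by
  rw [permTerm_symm, Matrix.transpose_submatrix, ← Matrix.charmatrix_transpose,
    permTerm_charmatrix_rotation _ hn hc]
  rfl

/-! ### Terms of a gain graph. -/

namespace UnitGainGraph

variable {V : Type*} {G : SimpleGraph V}

theorem adjMatrix_apply_of_adj (Φ : UnitGainGraph G) {u v : V} (h : G.Adj u v) :
    Φ.adjMatrix u v = Φ.gain ⟨(u, v), h⟩ := by
  simp [adjMatrix, h]

theorem adjMatrix_apply_of_not_adj (Φ : UnitGainGraph G) {u v : V} (h : ¬ G.Adj u v) :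
    Φ.adjMatrix u v = 0 := by
  simp [adjMatrix, h]

theorem adjMatrix_apply_symm (Φ : UnitGainGraph G) (u v : V) :
    Φ.adjMatrix v u = (starRingEnd ℂ) (Φ.adjMatrix u v) := by
  by_cases h : G.Adj u v
  · rw [Φ.adjMatrix_apply_of_adj h, Φ.adjMatrix_apply_of_adj h.symm, ← Circle.coe_inv_eq_conj,
      ← Φ.gain_symm]
    rfl
  · rw [Φ.adjMatrix_apply_of_not_adj h, Φ.adjMatrix_apply_of_not_adj fun h' => h h'.symm, map_zero]

theorem adjMatrix_mul_adjMatrix (Φ : UnitGainGraph G) {u v : V} (h : G.Adj u v) :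
    Φ.adjMatrix u v * Φ.adjMatrix v u = 1 := by
  rw [Φ.adjMatrix_apply_symm u v, Φ.adjMatrix_apply_of_adj h, ← Circle.coe_inv_eq_conj,
    ← Circle.coe_mul, mul_inv_cancel, Circle.coe_one]

/-- The two rotations of a cycle together contribute twice the real part of its gain. -/
theorem permTerm_rotation_add [Fintype V] [DecidableEq V] (Φ : UnitGainGraph G) {n : ℕ}
    (hn : 3 ≤ n) (c : SimpleGraph.Copy (SimpleGraph.cycleGraph n) G) :
    permTerm (Φ.adjMatrix.charmatrix.submatrix c c) (finRotate n) +
      permTerm (Φ.adjMatrix.charmatrix.submatrix c c) (finRotate n).symm =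
        -C (2 * (((Φ.cycleGain hn c : ℂ).re : ℝ) : ℂ)) := by
  have h : ∏ i, Φ.adjMatrix (c i) (c (finRotate n i)) = (Φ.cycleGain hn c : ℂ) := by
    refine Eq.trans (Finset.prod_congr rfl fun i _ => ?_) (map_prod Circle.coeHom _ _).symm
    exact Φ.adjMatrix_apply_of_adj (c.toHom.map_adj (cycleGraph_adj_finRotate hn i))
  have h' : ∏ i, Φ.adjMatrix (c (finRotate n i)) (c i) =
      (starRingEnd ℂ) (Φ.cycleGain hn c : ℂ) := by
    rw [← h, map_prod]
    exact Finset.prod_congr rfl fun i _ => Φ.adjMatrix_apply_symm _ _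
  have hc : Function.Injective (fun i => c i) := c.injective
  rw [permTerm_charmatrix_rotation _ hn hc, permTerm_charmatrix_rotation_symm _ hn hc, h, h',
    ← neg_add, ← C_add, add_comm, Complex.add_conj]
  push_cast
  rfl

theorem involutionSum_submatrix [Fintype V] [DecidableEq V] (Φ : UnitGainGraph G) {U : Type*}
    [Fintype U] [DecidableEq U] (H : SimpleGraph U) {f : U → V} (hf : Function.Injective f)
    (hH : ∀ u v, H.Adj u v ↔ G.Adj (f u) (f v)) :
    involutionSum (Φ.adjMatrix.charmatrix.submatrix f f) = matchingPoly H := by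
  rw [charmatrix_submatrix _ hf]
  exact involutionSum_charmatrix
    (fun u v h => Φ.adjMatrix_mul_adjMatrix ((hH u v).1 h))
    (fun u v h => Φ.adjMatrix_apply_of_not_adj fun h' => h ((hH u v).2 h'))

end UnitGainGraph

/-! ### Bridges and permutation patterns of the dumbbell. -/

/-- The height of a vertex of the dumbbell graph above the left cycle, along the path. -/
def dumbbellHeight {r s ℓ : ℕ} : DumbbellVertex r s ℓ → ℕ
  | .inl _ => 0
  | .inr (.inl _) => ℓ
  | .inr (.inr k) => k + 1

/-- Heights change only along the path, by one per edge, so each threshold `t` is crossed by at most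
one edge. -/
theorem dumbbell_bridge_unique {r s ℓ : ℕ} {p : Fin r} {q : Fin s} {t : ℕ}
    {u v a b : DumbbellVertex r s ℓ} (huv : (dumbbell r s ℓ p q).Adj u v)
    (hab : (dumbbell r s ℓ p q).Adj a b) (hu : dumbbellHeight u ≤ t) (hv : t < dumbbellHeight v)
    (ha : dumbbellHeight a ≤ t) (hb : t < dumbbellHeight b) : a = u ∧ b = v := by
  change dumbbellAdj p q u v at huv
  change dumbbellAdj p q a b at hab
  rcases u with u | u | ⟨u, hu'⟩ <;> rcases v with v | v | ⟨v, hv'⟩ <;>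
  simp only [dumbbellHeight, dumbbellAdj, SimpleGraph.pathGraph_adj] at hu hv huv <;>
  first
  | omega
  | (rcases a with a | a | ⟨a, ha'⟩ <;> rcases b with b | b | ⟨b, hb'⟩ <;>
      simp only [dumbbellHeight, dumbbellAdj, SimpleGraph.pathGraph_adj] at ha hb hab <;>
      first
      | omega
      | (simp only [Sum.inr.injEq, Fin.mk.injEq, and_true, hab, huv] <;> omega))

theorem dumbbell_involution_of_height_ne {r s ℓ : ℕ} {p : Fin r} {q : Fin s}
    {σ : Equiv.Perm (DumbbellVertex r s ℓ)}
    (hσ : ∀ v, σ v ≠ v → (dumbbell r s ℓ p q).Adj v (σ v)) {v : DumbbellVertex r s ℓ}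
    (hv : dumbbellHeight v ≠ dumbbellHeight (σ v)) : σ (σ v) = v := by
  have hadj := hσ v fun h => hv (by rw [h])
  rcases lt_or_gt_of_ne hv with h | h
  -- Going up, the near side of the bridge is a sublevel set; going down, it is a superlevel set.
  · exact apply_eq_of_bridge hσ (S := {a | dumbbellHeight a ≤ dumbbellHeight v}) (not_le.2 h)
      (fun a ha b hb hab => dumbbell_bridge_unique hadj hab le_rfl h ha (not_le.1 hb))
      (le_refl (dumbbellHeight v)) rfl
  · refine apply_eq_of_bridge hσ (S := {a | dumbbellHeight (σ v) < dumbbellHeight a})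
      (lt_irrefl (dumbbellHeight (σ v))) (fun a ha b hb hab => ?_) h rfl
    exact (dumbbell_bridge_unique hadj.symm hab.symm le_rfl h (not_lt.1 hb) ha).symm

/-- Multiply each nonzero `w i` by `1 = (L₀ + L₁ + L₂) * (R₀ + R₁ + R₂)`, read as indicators, and
expand. -/
theorem sum_eq_sum_patterns {ι R : Type*} [Fintype ι] [CommRing R] (w : ι → R)
    (P L₀ L₁ L₂ R₀ R₁ R₂ : ι → Prop) [DecidablePred P] [DecidablePred L₀] [DecidablePred L₁]
    [DecidablePred L₂] [DecidablePred R₀] [DecidablePred R₁] [DecidablePred R₂]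
    (hP : ∀ i, w i ≠ 0 → P i)
    (hL : ∀ i, w i ≠ 0 →
      (if L₀ i then 1 else 0) + (if L₁ i then 1 else 0) + (if L₂ i then 1 else 0) = (1 : R))
    (hR : ∀ i, w i ≠ 0 →
      (if R₀ i then 1 else 0) + (if R₁ i then 1 else 0) + (if R₂ i then 1 else 0) = (1 : R)) :
    ∑ i, w i =
      ∑ i with P i ∧ L₀ i ∧ R₀ i, w i + ∑ i with P i ∧ L₁ i ∧ R₀ i, w i +
        ∑ i with P i ∧ L₂ i ∧ R₀ i, w i + ∑ i with P i ∧ L₀ i ∧ R₁ i, w i +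
        ∑ i with P i ∧ L₀ i ∧ R₂ i, w i + ∑ i with P i ∧ L₁ i ∧ R₁ i, w i +
        ∑ i with P i ∧ L₁ i ∧ R₂ i, w i + ∑ i with P i ∧ L₂ i ∧ R₁ i, w i +
        ∑ i with P i ∧ L₂ i ∧ R₂ i, w i := by
  simp only [Finset.sum_filter, ← Finset.sum_add_distrib]
  refine Finset.sum_congr rfl fun i _ => ?_
  by_cases hi : w i = 0
  · simp [hi]
  · have key : ∀ X Y : Prop, ∀ [Decidable X] [Decidable Y], (if P i ∧ X ∧ Y then w i else 0) =
        w i * ((if X then 1 else 0) * (if Y then 1 else 0)) := fun X Y _ _ => by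
      by_cases hX : X <;> by_cases hY : Y <;> simp [hX, hY, hP i hi]
    simp only [key]
    linear_combination (-w i) * hL i hi -
      w i * ((if L₀ i then 1 else 0) + (if L₁ i then 1 else 0) + (if L₂ i then 1 else 0)) * hR i hi

/-- The vertices on a copy of a graph together with the remaining vertices. -/
noncomputable def sumComplRangeEquiv {W V : Type*} {c : W → V} (hc : Function.Injective c) :
    W ⊕ ↥((Set.range c)ᶜ) ≃ V :=
  open Classical in ((Equiv.ofInjective c hc).sumCongr (Equiv.refl _)).trans (Equiv.Set.sumCompl _)

theorem sum_permTerm_deleteCopy {V W : Type*} [Fintype V] [DecidableEq V] [Fintype W]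
    [DecidableEq W] {G : SimpleGraph V} {H : SimpleGraph W} (Φ : UnitGainGraph G)
    (c : SimpleGraph.Copy H G) (ρ : Equiv.Perm W) (P : Equiv.Perm V → Prop) [DecidablePred P]
    (hP : ∀ σ, P σ ↔ (∀ i, σ (c i) = c (ρ i)) ∧ ∀ v ∉ Set.range c, σ (σ v) = v) :
    ∑ σ with P σ, permTerm Φ.adjMatrix.charmatrix σ =
      permTerm (Φ.adjMatrix.charmatrix.submatrix c c) ρ * matchingPoly (deleteCopy G c) := by
  classical
  rw [sum_permTerm_of_apply_eq _ (sumComplRangeEquiv c.injective) ρ P fun σ => ?_]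
  · congr 1
    exact Φ.involutionSum_submatrix _ Subtype.val_injective fun u v => Iff.rfl
  · rw [hP]
    exact and_congr Iff.rfl ⟨fun h j => h j j.2, fun h v hv => h ⟨v, hv⟩⟩

/-- A vertex of `C_r` with `σ² ≠ id` there keeps its height 0, and since `ℓ ≥ 1` only `C_r` has
height 0; so it moves along the cycle. -/
theorem dumbbell_involution_or_rotation_left {r s ℓ : ℕ} (hr : 3 ≤ r) {p : Fin r} {q : Fin s}
    {σ : Equiv.Perm (DumbbellVertex r s ℓ)}
    (hσ : ∀ v, σ v ≠ v → (dumbbell r s ℓ p q).Adj v (σ v)) (hℓ : 1 ≤ ℓ) :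
    let c := dumbbellCycleLeft r s ℓ p q
    (∀ i, σ (σ (c i)) = c i) ∨ (∀ i, σ (c i) = c (finRotate r i)) ∨
      ∀ i, σ (c i) = c ((finRotate r).symm i) := by
  intro c
  refine involution_or_rotation (finRotate_sameCycle hr) fun i hi => ?_
  have hh : dumbbellHeight (c i) = dumbbellHeight (σ (c i)) := by
    by_contra hne
    exact hi (dumbbell_involution_of_height_ne hσ hne)
  have hadj := hσ (c i) fun h => hi (by rw [h, h])
  generalize σ (c i) = v at hh hadj
  rcases v with j | j | k
  · exact (cycleGraph_adj_iff_finRotate hr hadj).imp (congrArg Sum.inl) (congrArg Sum.inl)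
  · change 0 = ℓ at hh; omega
  · change 0 = (k : ℕ) + 1 at hh; omega

theorem dumbbell_involution_or_rotation_right {r s ℓ : ℕ} (hs : 3 ≤ s) {p : Fin r} {q : Fin s}
    {σ : Equiv.Perm (DumbbellVertex r s ℓ)}
    (hσ : ∀ v, σ v ≠ v → (dumbbell r s ℓ p q).Adj v (σ v)) (hℓ : 1 ≤ ℓ) :
    let c := dumbbellCycleRight r s ℓ p q
    (∀ i, σ (σ (c i)) = c i) ∨ (∀ i, σ (c i) = c (finRotate s i)) ∨
      ∀ i, σ (c i) = c ((finRotate s).symm i) := by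
  intro c
  refine involution_or_rotation (finRotate_sameCycle hs) fun i hi => ?_
  have hh : dumbbellHeight (c i) = dumbbellHeight (σ (c i)) := by
    by_contra hne
    exact hi (dumbbell_involution_of_height_ne hσ hne)
  have hadj := hσ (c i) fun h => hi (by rw [h, h])
  generalize σ (c i) = v at hh hadj
  rcases v with j | j | ⟨k, hk⟩
  · change ℓ = 0 at hh; omega
  · exact (cycleGraph_adj_iff_finRotate hs hadj).imp (congrArg (Sum.inr ∘ Sum.inl))
      (congrArg (Sum.inr ∘ Sum.inl))
  · change ℓ = k + 1 at hh; omega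

/-- An interior path vertex has no neighbour of its own height, so moving it always crosses a
bridge. -/
theorem dumbbell_involution_path {r s ℓ : ℕ} {p : Fin r} {q : Fin s}
    {σ : Equiv.Perm (DumbbellVertex r s ℓ)}
    (hσ : ∀ v, σ v ≠ v → (dumbbell r s ℓ p q).Adj v (σ v)) (k : Fin (ℓ - 1)) :
    σ (σ (.inr (.inr k))) = .inr (.inr k) := by
  by_contra hne
  have hh : dumbbellHeight (.inr (.inr k) : DumbbellVertex r s ℓ) =
      dumbbellHeight (σ (.inr (.inr k))) := by
    by_contra h
    exact hne (dumbbell_involution_of_height_ne hσ h)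
  have hadj := hσ (.inr (.inr k)) fun h => hne (by rw [h, h])
  generalize σ (.inr (.inr k)) = v at hh hadj
  obtain ⟨k, hk⟩ := k
  rcases v with j | j | ⟨k', hk'⟩
  · change k + 1 = 0 at hh; omega
  · change k + 1 = ℓ at hh; omega
  · have hadj := SimpleGraph.pathGraph_adj.1 (show (SimpleGraph.pathGraph (ℓ - 1)).Adj _ _ from hadj)
    change k + 1 = k' + 1 at hh
    simp only at hadj
    omega

theorem sum_permTerm_dumbbell_both {r s ℓ : ℕ} {p : Fin r} {q : Fin s}
    (Φ : UnitGainGraph (dumbbell r s ℓ p q)) (ρ : Equiv.Perm (Fin r)) (ρ' : Equiv.Perm (Fin s))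
    (P : Equiv.Perm (DumbbellVertex r s ℓ) → Prop) [DecidablePred P]
    (hP : ∀ σ, P σ ↔ (∀ k, σ (σ (.inr (.inr k))) = .inr (.inr k)) ∧
      (∀ i, σ (.inl i) = .inl (ρ i)) ∧ ∀ j, σ (.inr (.inl j)) = .inr (.inl (ρ' j))) :
    ∑ σ with P σ, permTerm Φ.adjMatrix.charmatrix σ =
      permTerm (Φ.adjMatrix.charmatrix.submatrix Sum.inl Sum.inl) ρ *
        permTerm (Φ.adjMatrix.charmatrix.submatrix (Sum.inr ∘ Sum.inl) (Sum.inr ∘ Sum.inl)) ρ' *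
          matchingPoly (SimpleGraph.pathGraph (ℓ - 1)) := by
  rw [sum_permTerm_of_apply_eq _ (Equiv.sumAssoc (Fin r) (Fin s) (Fin (ℓ - 1))) (ρ.sumCongr ρ') P
    fun σ => ?_, permTerm_sumCongr]
  · congr 1
    exact Φ.involutionSum_submatrix _ (f := Sum.inr ∘ Sum.inr)
      (Sum.inr_injective.comp Sum.inr_injective) fun u v => Iff.rfl
  · rw [hP]
    simp only [Sum.forall, Equiv.sumAssoc_apply_inl_inl, Equiv.sumAssoc_apply_inl_inr,
      Equiv.sumAssoc_apply_inr, Equiv.Perm.sumCongr_apply, Sum.map_inl, Sum.map_inr]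
    tauto

/-! ### Summing the nine patterns. -/

theorem mainTheorem1 (r s ℓ : ℕ) (hr : 3 ≤ r) (hs : 3 ≤ s) (hℓ : 1 ≤ ℓ)
    (p : Fin r) (q : Fin s) (Φ : UnitGainGraph (dumbbell r s ℓ p q)) (a b : ℝ)
    (ha : a = (Φ.cycleGain hr (dumbbellCycleLeft r s ℓ p q) : ℂ).re)
    (hb : b = (Φ.cycleGain hs (dumbbellCycleRight r s ℓ p q) : ℂ).re) :
    Φ.charPoly =
      matchingPoly (dumbbell r s ℓ p q)
        - C (2 * (a : ℂ)) *
            matchingPoly (deleteCopy (dumbbell r s ℓ p q) (dumbbellCycleLeft r s ℓ p q))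
        - C (2 * (b : ℂ)) *
            matchingPoly (deleteCopy (dumbbell r s ℓ p q) (dumbbellCycleRight r s ℓ p q))
        + C (4 * (a : ℂ) * (b : ℂ)) * matchingPoly (SimpleGraph.pathGraph (ℓ - 1)) := by
  classical
  have hL := Φ.permTerm_rotation_add hr (dumbbellCycleLeft r s ℓ p q)
  have hR := Φ.permTerm_rotation_add hs (dumbbellCycleRight r s ℓ p q)
  rw [← ha] at hL
  rw [← hb] at hR
  have : NeZero r := ⟨by omega⟩
  have : NeZero s := ⟨by omega⟩
  have hw : ∀ σ, permTerm Φ.adjMatrix.charmatrix σ ≠ 0 →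
      ∀ v, σ v ≠ v → (dumbbell r s ℓ p q).Adj v (σ v) := fun σ hσ v hv => by
    by_contra hG
    exact hσ (permTerm_charmatrix_eq_zero (fun u v => Φ.adjMatrix_apply_of_not_adj) hv hG)
  rw [UnitGainGraph.charPoly, Matrix.charpoly, Matrix.det_apply']
  change ∑ σ, permTerm Φ.adjMatrix.charmatrix σ = _
  -- The six cycle predicates left as `_` are read off from the indicator lemmas.
  rw [sum_eq_sum_patterns (permTerm Φ.adjMatrix.charmatrix)
    (fun σ => ∀ k, σ (σ (.inr (.inr k))) = .inr (.inr k)) _ _ _ _ _ _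
    (fun σ hσ => dumbbell_involution_path (hw σ hσ))
    (fun σ hσ => sum_indicator_involution_rotation (c := ⇑(dumbbellCycleLeft r s ℓ p q))
      (dumbbellCycleLeft r s ℓ p q).injective
      (finRotate_finRotate_ne hr) (dumbbell_involution_or_rotation_left hr (hw σ hσ) hℓ))
    (fun σ hσ => sum_indicator_involution_rotation (c := ⇑(dumbbellCycleRight r s ℓ p q))
      (dumbbellCycleRight r s ℓ p q).injective
      (finRotate_finRotate_ne hs) (dumbbell_involution_or_rotation_right hs (hw σ hσ) hℓ))]
  have left := fun ρ => sum_permTerm_deleteCopy Φ (dumbbellCycleLeft r s ℓ p q) ρ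
    (fun σ => (∀ k, σ (σ (.inr (.inr k))) = .inr (.inr k)) ∧
      (∀ i, σ (dumbbellCycleLeft r s ℓ p q i) = dumbbellCycleLeft r s ℓ p q (ρ i)) ∧
      ∀ j, σ (σ (dumbbellCycleRight r s ℓ p q j)) = dumbbellCycleRight r s ℓ p q j)
    (fun σ => by
      constructor
      · rintro ⟨h1, h2, h3⟩
        refine ⟨h2, ?_⟩
        rintro (i | j | k) hv
        · exact absurd ⟨i, rfl⟩ hv
        · exact h3 j
        · exact h1 k
      · rintro ⟨h1, h2⟩
        exact ⟨fun k => h2 _ (by rintro ⟨i, hi⟩; cases hi), h1,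
          fun j => h2 _ (by rintro ⟨i, hi⟩; cases hi)⟩)
  have right := fun ρ => sum_permTerm_deleteCopy Φ (dumbbellCycleRight r s ℓ p q) ρ
    (fun σ => (∀ k, σ (σ (.inr (.inr k))) = .inr (.inr k)) ∧
      (∀ i, σ (σ (dumbbellCycleLeft r s ℓ p q i)) = dumbbellCycleLeft r s ℓ p q i) ∧
      ∀ j, σ (dumbbellCycleRight r s ℓ p q j) = dumbbellCycleRight r s ℓ p q (ρ j))
    (fun σ => by
      constructor
      · rintro ⟨h1, h2, h3⟩
        refine ⟨h3, ?_⟩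
        rintro (i | j | k) hv
        · exact h2 i
        · exact absurd ⟨j, rfl⟩ hv
        · exact h1 k
      · rintro ⟨h1, h2⟩
        exact ⟨fun k => h2 _ (by rintro ⟨i, hi⟩; cases hi),
          fun j => h2 _ (by rintro ⟨i, hi⟩; cases hi), h1⟩)
  have both := fun ρ ρ' => sum_permTerm_dumbbell_both Φ ρ ρ'
    (fun σ => (∀ k, σ (σ (.inr (.inr k))) = .inr (.inr k)) ∧
      (∀ i, σ (dumbbellCycleLeft r s ℓ p q i) = dumbbellCycleLeft r s ℓ p q (ρ i)) ∧
      ∀ j, σ (dumbbellCycleRight r s ℓ p q j) = dumbbellCycleRight r s ℓ p q (ρ' j))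
    (fun σ => Iff.rfl)
  have neither : ∑ σ : Equiv.Perm (DumbbellVertex r s ℓ) with
      (∀ k, σ (σ (.inr (.inr k))) = .inr (.inr k)) ∧
      (∀ i, σ (σ (dumbbellCycleLeft r s ℓ p q i)) = dumbbellCycleLeft r s ℓ p q i) ∧
      (∀ j, σ (σ (dumbbellCycleRight r s ℓ p q j)) = dumbbellCycleRight r s ℓ p q j),
      permTerm Φ.adjMatrix.charmatrix σ = matchingPoly (dumbbell r s ℓ p q) := by
    rw [← Φ.involutionSum_submatrix (dumbbell r s ℓ p q) Function.injective_id fun _ _ => Iff.rfl]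
    refine Finset.sum_congr (Finset.filter_congr fun σ _ => ?_) fun _ _ => rfl
    constructor
    · rintro ⟨h1, h2, h3⟩ (i | j | k)
      · exact h2 i
      · exact h3 j
      · exact h1 k
    · exact fun h => ⟨fun k => h _, fun i => h _, fun j => h _⟩
  rw [neither, left, left, right, right, both, both, both, both]
  -- The cycle copies unfold to the sum injections, so that all patterns share the same four
  -- rotation terms.
  change permTerm (Φ.adjMatrix.charmatrix.submatrix Sum.inl Sum.inl) _ +
    permTerm (Φ.adjMatrix.charmatrix.submatrix Sum.inl Sum.inl) _ = _ at hL
  change permTerm (Φ.adjMatrix.charmatrix.submatrix (Sum.inr ∘ Sum.inl) (Sum.inr ∘ Sum.inl)) _ +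
    permTerm (Φ.adjMatrix.charmatrix.submatrix (Sum.inr ∘ Sum.inl) (Sum.inr ∘ Sum.inl)) _ = _ at hR
  change _ + permTerm (Φ.adjMatrix.charmatrix.submatrix Sum.inl Sum.inl) _ * _ +
    permTerm (Φ.adjMatrix.charmatrix.submatrix Sum.inl Sum.inl) _ * _ +
    permTerm (Φ.adjMatrix.charmatrix.submatrix (Sum.inr ∘ Sum.inl) (Sum.inr ∘ Sum.inl)) _ * _ +
    permTerm (Φ.adjMatrix.charmatrix.submatrix (Sum.inr ∘ Sum.inl) (Sum.inr ∘ Sum.inl)) _ * _ +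
    _ + _ + _ + _ = _
  have hab : C (4 * (a : ℂ) * (b : ℂ)) = C (2 * (a : ℂ)) * C (2 * (b : ℂ)) := by
    rw [← C_mul]; ring_nf
  rw [hab]
  generalize permTerm (Φ.adjMatrix.charmatrix.submatrix Sum.inl Sum.inl) (finRotate r) = x at *
  generalize permTerm (Φ.adjMatrix.charmatrix.submatrix Sum.inl Sum.inl) (finRotate r).symm = x'
    at *
  generalize permTerm (Φ.adjMatrix.charmatrix.submatrix (Sum.inr ∘ Sum.inl) (Sum.inr ∘ Sum.inl))
    (finRotate s) = y at *
  generalize permTerm (Φ.adjMatrix.charmatrix.submatrix (Sum.inr ∘ Sum.inl) (Sum.inr ∘ Sum.inl))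
    (finRotate s).symm = y' at *
  -- Only the sums `x + x' = -2a` and `y + y' = -2b` are known and needed: the four mixed products
  -- add up to `(x + x') * (y + y') = 4ab`.
  obtain rfl : x' = -C (2 * (a : ℂ)) - x := by linear_combination hL
  obtain rfl : y' = -C (2 * (b : ℂ)) - y := by linear_combination hR
  ring
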